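/- **Setting.** Let $(\theta_i,H_i,S_i)$, $i=1,2,\dots$, be i.i.d. triples, where $\theta_i\in\{0,1\}$ is unobserved ($\theta_i=0$ means that the $i$-th null hypothesis is true) and the statistic $H_i\in\mathbb R$ and the standard error $S_i\in\mathbb R$ are observed. The pair $(\theta_i,H_i)$ follows a two-group mixture: $P(\theta_i=0)=\pi_0\in[0,1]$, and $H_i$ has density $f_0$ given $\theta_i=0$ and density $f_1$ given $\theta_i=1$. Put $f=\pi_0f_0+(1-\pi_0)f_1$ and $\mathrm{lfdr}(h)=\pi_0f_0(h)/f(h)$. Assume that $P(\theta_i=0\mid H_i,S_i)=\mathrm{lfdr}(H_i)$ almost surely and that $f(H_i+S_i)>0$ almost surely. Let $\alpha>0$ be the nominal level, let $c_i\in[c_{\min},c_{\max}]$ with $0<c_{\min}\le c_{\max}<\infty$ be non-random costs and $pr_i>0$ non-random baseline profits (the case $c_i\equiv pr_i\equiv 1$ is included). **Estimates.** For every $m$ let $\widehat{\mathrm{lfdr}}_m(\cdot)$ be a random function with values in $(0,1]$ that is determined by the data $(H_i,S_i)_{i\le m}$ (jointly measurable in the data and the argument). **The data-driven RBL procedure**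 for $m$ tests. Let $\hat l_i=\widehat{\mathrm{lfdr}}_m(H_i)$, $\hat l_i'=\widehat{\mathrm{lfdr}}_m(H_i+S_i)$, let $\hat N_i=(\hat l_i-\alpha)c_i$ be the weight and $\hat V_i=pr_i(\hat l_i/\hat l_i'-1)$ the value of test $i$. 1. Include all tests with $\hat l_i<\alpha$. The capacity is $C_T=\sum_{i:\hat l_i<\alpha}(\alpha-\hat l_i)c_i$. 2. Discard the tests that are not included and have $\hat V_i<0$; secure the tests that are included and have $\hat V_i>0$. Rank the remaining tests by decreasing ratio $\hat V_i/\hat N_i$ (read as $+\infty$ if $\hat N_i=0$; ties are broken by the index). 3. Let $C(j)$ be the sum of $|\hat N_i|$ over the first $j$ ranked tests and $k=\max\{j: C(j)\le C_T\}$. Among the first $k$ ranked tests, add those that are not included and remove those that are included. Reject the null hypotheses of the tests that are then included. Let $\mathcal R_m$ be the set of rejected hypotheses and $$\mathrm{FDP}_m=\frac{\sum_{i\in\mathcal R_m}(1-\theta_i)c_i}{\sum_{i\in\mathcal R_m}c_i}\quad(\text{and }0\text{ if }\mathcal R_m=\emptyset),\qquad \mathrm{FDR}_m=E[\mathrm{FDP}_m],$$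 which is the usual false discovery rate if $c_i\equiv1$. **Proposition.** Assume that the estimates are consistent in average $L_1$ norm, i.e. $$\frac1m\sum_{i=1}^m\bigl|\widehat{\mathrm{lfdr}}_m(H_i)-\mathrm{lfdr}(H_i)\bigr|\to0\quad\text{and}\quad \frac1m\sum_{i=1}^m\bigl|\widehat{\mathrm{lfdr}}_m(H_i+S_i)-\mathrm{lfdr}(H_i+S_i)\bigr|\to0$$ in probability as $m\to\infty$, and that for some constant $\widetilde p_\alpha>0$, with $(H,S)$ distributed as $(H_1,S_1)$, $$P\bigl(\mathrm{lfdr}(H+S)<\mathrm{lfdr}(H)<\alpha\bigr)\ \ge\ \widetilde p_\alpha .$$ Then $\mathrm{FDP}_m$ is integrable for every $m$, and $\mathrm{FDR}_m\le\alpha+o(1)$ as $m\to\infty$. -/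

import Mathlib

open MeasureTheory ProbabilityTheory Filter Topology

noncomputable section

namespace RBL

/-- The marginal density `f = π₀ f₀ + (1 - π₀) f₁` of the two-group mixture. -/
def mixtureDensity (π₀ : ℝ) (f₀ f₁ : ℝ → ℝ) (h : ℝ) : ℝ :=
  π₀ * f₀ h + (1 - π₀) * f₁ h

/-- The (oracle) local false discovery rate `π₀ f₀ / f`. -/
def lfdr (π₀ : ℝ) (f₀ f₁ : ℝ → ℝ) (h : ℝ) : ℝ :=
  π₀ * f₀ h / mixtureDensity π₀ f₀ f₁ h

/-- The data generating process. Experiment `i` has the unobserved state `θ i` (`0` for the null,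
`1` for the non-null), the observed standardized statistic `H i` and the observed standard error
`S i`. The triples are i.i.d., `(θ i, H i)` follows the two-group mixture with null probability `π₀`
and null and non-null densities `f₀`, `f₁`, and the conditional probability of the null given the
data of experiment `i` is `lfdr (H i)`. -/
structure TwoGroupModel {Ω : Type*} [MeasurableSpace Ω] (P : Measure Ω) (π₀ : ℝ) (f₀ f₁ : ℝ → ℝ)
    (θ : ℕ → Ω → Fin 2) (H S : ℕ → Ω → ℝ) : Prop where
  measurable_state : ∀ i, Measurable (θ i)
  measurable_stat : ∀ i, Measurable (H i)
  measurable_scale : ∀ i, Measurable (S i)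
  indep : iIndepFun (fun i ω => (θ i ω, H i ω, S i ω)) P
  ident : ∀ i, IdentDistrib (fun ω => (θ i ω, H i ω, S i ω)) (fun ω => (θ 0 ω, H 0 ω, S 0 ω)) P P
  nullProb_mem : π₀ ∈ Set.Icc (0 : ℝ) 1
  measurable_null : Measurable f₀
  measurable_alt : Measurable f₁
  null_nonneg : ∀ h, 0 ≤ f₀ h
  alt_nonneg : ∀ h, 0 ≤ f₁ h
  lintegral_null : ∫⁻ h, ENNReal.ofReal (f₀ h) = 1
  lintegral_alt : ∫⁻ h, ENNReal.ofReal (f₁ h) = 1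
  /-- `P(θ = 0, H ∈ B) = π₀ ∫_B f₀` -/
  null_law : ∀ i, (P.restrict {ω | θ i ω = 0}).map (H i) =
    ENNReal.ofReal π₀ • volume.withDensity (fun h => ENNReal.ofReal (f₀ h))
  /-- `P(θ = 1, H ∈ B) = (1 - π₀) ∫_B f₁` -/
  alt_law : ∀ i, (P.restrict {ω | θ i ω = 1}).map (H i) =
    ENNReal.ofReal (1 - π₀) • volume.withDensity (fun h => ENNReal.ofReal (f₁ h))
  /-- `P(θ = 0 | H, S) = lfdr(H)`: the standard error brings no information on the state beyond
  the standardized statistic. -/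
  posterior : ∀ i, P[Set.indicator {ω | θ i ω = 0} (fun _ => (1 : ℝ)) |
      MeasurableSpace.comap (fun ω => (H i ω, S i ω)) inferInstance]
    =ᵐ[P] fun ω => lfdr π₀ f₀ f₁ (H i ω)
  /-- `lfdr (H + S)` is well defined. (That `lfdr (H)` is, almost surely, is automatic.) -/
  mixture_pos : ∀ i, ∀ᵐ ω ∂P, 0 < mixtureDensity π₀ f₀ f₁ (H i ω + S i ω)

/-! ### The ranking-by-lifts procedure

The input for `m` tests is: the level `α`, the costs `c i`, the baseline profits `pr i`, the
(estimated) lfdr `l i` at `h i`, and the (estimated) lfdr `l' i` at `h i + s i`. -/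

section Procedure

variable {m : ℕ} (α : ℝ) (c pr l l' : Fin m → ℝ)

/-- The weight of a test. -/
def weight (i : Fin m) : ℝ := (l i - α) * c i

/-- The value of a test: the profit times the conditional expectation of the lift. -/
def value (i : Fin m) : ℝ := pr i * (l i / l' i - 1)

/-- The tests that are initially included in the knapsack. -/
def base : Finset (Fin m) := Finset.univ.filter fun i => l i < α

/-- The total capacity of the knapsack. -/
def capacity : ℝ := ∑ i ∈ base α l, (α - l i) * c i

open Classical in
/-- The tests that remain to be ranked: neither discarded (not included, negative value) nor
secured (included, positive value). -/
def ranked : Finset (Fin m) := Finset.univ.filter fun i =>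
  ¬ (i ∉ base α l ∧ value pr l l' i < 0) ∧ ¬ (i ∈ base α l ∧ 0 < value pr l l' i)

open Classical in
/-- The value to weight ratio. A ranked test of weight zero has a non-negative value and uses no
capacity; its ratio is `+∞`. -/
def ratio (i : Fin m) : EReal :=
  if weight α c l i = 0 then ⊤ else ((value pr l l' i / weight α c l i : ℝ) : EReal)

/-- `j` stands at or before `i` in the decreasing order of the ratios; ties are broken by the
index. -/
def AtOrBefore (j i : Fin m) : Prop :=
  ratio α c pr l l' i < ratio α c pr l l' j ∨ (ratio α c pr l l' i = ratio α c pr l l' j ∧ j ≤ i)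

open Classical in
/-- The capacity that is used once all ranked tests up to and including `i` have been processed:
adding a test that is not included, or removing one that is, uses the absolute value of its
weight. -/
def usedCapacity (i : Fin m) : ℝ :=
  ∑ j ∈ (ranked α pr l l').filter (fun j => AtOrBefore α c pr l l' j i), |weight α c l j|

open Classical in
/-- The ranked tests that are processed before the capacity is exhausted. As `usedCapacity` is
monotone along the ranking, they are the first `k` tests of the ranking, with `k` maximal such that
the capacity used by them is at most the total capacity. -/
def switched : Finset (Fin m) :=
  (ranked α pr l l').filter fun i => usedCapacity α c pr l l' i ≤ capacity α c l

/-- The rejected hypotheses: the switched tests that were not included are added, and those that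
were included are removed. -/
def rejections : Finset (Fin m) :=
  (base α l \ switched α c pr l l') ∪ (switched α c pr l l' \ base α l)

end Procedure

section DataDriven

variable {Ω : Type*} (α : ℝ) (c pr : ℕ → ℝ) (lfdrHat : (m : ℕ) → (Fin m → ℝ × ℝ) → ℝ → ℝ)
  (θ : ℕ → Ω → Fin 2) (H S : ℕ → Ω → ℝ)

/-- The data of the first `m` experiments. -/
def data (m : ℕ) (ω : Ω) : Fin m → ℝ × ℝ := fun i => (H i ω, S i ω)

/-- The rejections of the data-driven procedure: the procedure applied to the estimated lfdr. -/
def dataDrivenRejections (m : ℕ) (ω : Ω) : Finset (Fin m) :=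
  rejections α (fun i => c i) (fun i => pr i)
    (fun i => lfdrHat m (data H S m ω) (H i ω))
    (fun i => lfdrHat m (data H S m ω) (H i ω + S i ω))

/-- The cost-weighted false discovery proportion `∑ (1 - θ i) δ i c i / ∑ δ i c i` of the
data-driven procedure; it is `0` when nothing is rejected. -/
def fdp (m : ℕ) (ω : Ω) : ℝ :=
  (∑ i ∈ dataDrivenRejections α c pr lfdrHat H S m ω, (if θ i ω = 0 then c i else 0)) /
    ∑ i ∈ dataDrivenRejections α c pr lfdrHat H S m ω, c i

/-- The false discovery rate of the data-driven procedure. -/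
def fdr [MeasurableSpace Ω] (P : Measure Ω) (m : ℕ) : ℝ :=
  ∫ ω, fdp α c pr lfdrHat θ H S m ω ∂P

end DataDriven

end RBL

end

/-!
The rejections are a function of the observed data alone. Given the data of all experiments, the
null of test `i` holds with probability `lfdr (H i)`: this is the posterior of experiment `i`, and
the other experiments are independent of it (`integral_null_mul_eq`). Hence the FDR equals the
expectation of the cost-weighted average of `lfdr (H i)` over the rejected tests
(`fdr_eq_integral_lfdr`), and there is no fluctuation of the states to control.

The capacity constraint makes the same average of the estimated lfdr at most `α`
(`sum_weight_rejections_nonpos`). Replacing the estimates by the true lfdr costs at most the total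
`L₁` error `o(m)`, relative to the total cost of the rejected tests. That cost is of order `m`: a
secured test, with `l' < l < α`, is always rejected. Since `lfdr (H + S) < lfdr H < α` has positive
probability, it holds with a margin `δ` with positive probability (`exists_margin`), hence by the law
of large numbers for a positive fraction of the tests, and consistency lets only `o(m)` of these
have an estimation error above `δ` (`sum_indicator_sub_le_card_rejections`). The two bounds combine
in `sum_mul_rejections_div_le`; it holds with probability tending to one, which suffices because the
average of the lfdr never exceeds one.
-/

namespace RBL

/-! ### Capacity and secured tests -/

section Procedure

variable {m : ℕ} {α : ℝ} {c pr l l' : Fin m → ℝ}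

theorem mem_base {i : Fin m} : i ∈ base α l ↔ l i < α := by
  simp [base]

theorem capacity_nonneg (hc : ∀ i, 0 ≤ c i) : 0 ≤ capacity α c l :=
  Finset.sum_nonneg fun i hi =>
    mul_nonneg (sub_nonneg.2 (mem_base.1 hi).le) (hc i)

/-- The switched tests form an initial segment of the ranking, so the capacity used at the last of
them is the total absolute weight of all of them. -/
theorem sum_abs_weight_switched_le (hc : ∀ i, 0 ≤ c i) :
    ∑ i ∈ switched α c pr l l', |weight α c l i| ≤ capacity α c l := by
  classical
  rcases (switched α c pr l l').eq_empty_or_nonempty with h | h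
  · rw [h, Finset.sum_empty]
    exact capacity_nonneg hc
  -- The lexicographic order by decreasing ratio, then index, is the ranking; `i` is its last
  -- switched test.
  · obtain ⟨i, hi, hmax⟩ := Finset.exists_max_image (switched α c pr l l')
      (fun i => toLex (OrderDual.toDual (ratio α c pr l l' i), i)) h
    have hi' : usedCapacity α c pr l l' i ≤ capacity α c l := by
      unfold switched at hi
      exact (Finset.mem_filter.1 hi).2
    refine le_trans ?_ hi'
    unfold usedCapacity
    refine Finset.sum_le_sum_of_subset_of_nonneg ?_ fun _ _ _ => abs_nonneg _
    intro j hj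
    have hjr : j ∈ ranked α pr l l' := by
      unfold switched at hj
      exact (Finset.mem_filter.1 hj).1
    refine Finset.mem_filter.2 ⟨hjr, ?_⟩
    have := hmax j hj
    rw [Prod.Lex.toLex_le_toLex] at this
    rcases this with h | ⟨h, h'⟩
    · exact Or.inl h
    · exact Or.inr ⟨(OrderDual.toDual_inj.1 h).symm, h'⟩

/-- The procedure keeps the estimated false discovery proportion below the level: the included
tests contribute minus the capacity, and every switched test, whether added or removed, contributes
its absolute weight. -/
theorem sum_weight_rejections_nonpos (hc : ∀ i, 0 ≤ c i) :
    ∑ i ∈ rejections α c pr l l', weight α c l i ≤ 0 := by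
  classical
  have hbase : ∑ i ∈ base α l, weight α c l i = -capacity α c l := by
    rw [capacity, ← Finset.sum_neg_distrib]
    exact Finset.sum_congr rfl fun i _ => by rw [weight]; ring
  have key : ∑ i ∈ rejections α c pr l l', weight α c l i
      = ∑ i ∈ base α l, weight α c l i + ∑ i ∈ switched α c pr l l', |weight α c l i| := by
    have hrej : rejections α c pr l l' =
        (base α l \ switched α c pr l l') ∪ (switched α c pr l l' \ base α l) := by
      unfold rejections; congr!
    rw [hrej, Finset.sum_union (Finset.disjoint_left.2 fun i hi hi' =>
      (Finset.mem_sdiff.1 hi).2 (Finset.mem_sdiff.1 hi').1)]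
    have h1 := Finset.sum_inter_add_sum_sdiff (base α l) (switched α c pr l l')
      (weight α c l)
    have h2 := Finset.sum_inter_add_sum_sdiff (switched α c pr l l') (base α l)
      (fun i => |weight α c l i|)
    have h3 : ∑ i ∈ switched α c pr l l' ∩ base α l, |weight α c l i|
        = -∑ i ∈ base α l ∩ switched α c pr l l', weight α c l i := by
      rw [Finset.inter_comm, ← Finset.sum_neg_distrib]
      refine Finset.sum_congr rfl fun i hi => abs_of_nonpos ?_
      exact mul_nonpos_of_nonpos_of_nonneg
        (sub_nonpos.2 (mem_base.1 (Finset.mem_inter.1 hi).1).le) (hc i)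
    have h4 : ∑ i ∈ switched α c pr l l' \ base α l, |weight α c l i|
        = ∑ i ∈ switched α c pr l l' \ base α l, weight α c l i := by
      refine Finset.sum_congr rfl fun i hi => abs_of_nonneg ?_
      exact mul_nonneg
        (sub_nonneg.2 (not_lt.1 fun h => (Finset.mem_sdiff.1 hi).2 (mem_base.2 h))) (hc i)
    linarith
  rw [key, hbase]
  linarith [sum_abs_weight_switched_le (α := α) (pr := pr) (l := l) (l' := l') hc]

/-- A secured test is never ranked, hence never removed. -/
theorem mem_rejections_of_lt {i : Fin m} (hpr : 0 < pr i) (hl' : 0 < l' i) (hlt : l' i < l i)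
    (hα : l i < α) : i ∈ rejections α c pr l l' := by
  have hb : i ∈ base α l := mem_base.2 hα
  have hv : 0 < value pr l l' i :=
    mul_pos hpr (sub_pos.2 ((one_lt_div hl').2 hlt))
  have hs : i ∉ switched α c pr l l' := fun h => by
    unfold switched ranked at h
    exact (Finset.mem_filter.1 (Finset.mem_filter.1 h).1).2.2 ⟨hb, hv⟩
  unfold rejections
  exact Finset.mem_union_left _ (Finset.mem_sdiff.2 ⟨hb, hs⟩)

/-- If the lfdr `t i` is estimated by `l i`, the cost-weighted average of `t` over the rejected
tests exceeds the level by at most the total estimation error relative to the rejected cost. -/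
theorem sum_mul_rejections_le (hc : ∀ i, 0 ≤ c i) {b : ℝ} (hb : ∀ i, c i ≤ b) (t : Fin m → ℝ) :
    ∑ i ∈ rejections α c pr l l', t i * c i ≤
      α * ∑ i ∈ rejections α c pr l l', c i + b * ∑ i, |l i - t i| := by
  have h1 := sum_weight_rejections_nonpos (α := α) (pr := pr) (l := l) (l' := l') hc
  have h2 : ∑ i ∈ rejections α c pr l l', |l i - t i| * c i ≤ b * ∑ i, |l i - t i| := by
    rw [Finset.mul_sum]
    refine (Finset.sum_le_sum_of_subset_of_nonneg (Finset.subset_univ _) fun i _ _ =>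
      mul_nonneg (abs_nonneg _) (hc i)).trans (Finset.sum_le_sum fun i _ => ?_)
    rw [mul_comm]
    exact mul_le_mul_of_nonneg_right (hb i) (abs_nonneg _)
  have h3 : ∑ i ∈ rejections α c pr l l', t i * c i ≤ ∑ i ∈ rejections α c pr l l',
      (weight α c l i + α * c i + |l i - t i| * c i) := by
    refine Finset.sum_le_sum fun i _ => ?_
    have := mul_le_mul_of_nonneg_right (neg_abs_le (l i - t i)) (hc i)
    rw [weight]
    linarith
  rw [Finset.sum_add_distrib, Finset.sum_add_distrib, ← Finset.mul_sum] at h3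
  linarith

/-- A lower bound for the number of rejections: a test whose lfdr `t i` is below the level and above
`t' i`, both with a margin, is secured unless one of the estimates is off by more than `δ`. -/
theorem sum_indicator_sub_le_card_rejections (hpr : ∀ i, 0 < pr i) (hl' : ∀ i, 0 < l' i)
    {t t' : Fin m → ℝ} {δ : ℝ} (hδ : 0 < δ) :
    ∑ i, (if t' i + 2 * δ < t i ∧ t i + δ < α then (1 : ℝ) else 0)
      - (∑ i, |l i - t i| + ∑ i, |l' i - t' i|) / δ ≤ (rejections α c pr l l').card := by
  classical
  have hcard : ((rejections α c pr l l').card : ℝ)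
      = ∑ i, if i ∈ rejections α c pr l l' then (1 : ℝ) else 0 := by simp
  rw [hcard, ← Finset.sum_add_distrib, Finset.sum_div, ← Finset.sum_sub_distrib]
  refine Finset.sum_le_sum fun i _ => ?_
  have hnn : 0 ≤ (|l i - t i| + |l' i - t' i|) / δ := by positivity
  by_cases hgap : t' i + 2 * δ < t i ∧ t i + δ < α
  · rw [if_pos hgap]
    by_cases hclose : |l i - t i| + |l' i - t' i| < δ
    · have h1 := abs_lt.1 (lt_of_le_of_lt (le_add_of_nonneg_right (abs_nonneg (l' i - t' i))) hclose)
      have h2 := abs_lt.1 (lt_of_le_of_lt (le_add_of_nonneg_left (abs_nonneg (l i - t i))) hclose)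
      rw [if_pos (mem_rejections_of_lt (hpr i) (hl' i) (by linarith) (by linarith))]
      linarith
    · have : 1 ≤ (|l i - t i| + |l' i - t' i|) / δ := (one_le_div hδ).2 (not_lt.1 hclose)
      split_ifs <;> linarith
  · rw [if_neg hgap]
    split_ifs <;> linarith

/-- The lfdr averaged over the rejected tests is close to at most `α` when the estimates are close
on average and a positive fraction `r` of the tests satisfies `t' < t < α` with a margin. At most half
of these are lost to estimation errors above `δ`, by the choice of `η`. -/
theorem sum_mul_rejections_div_le (hm : 0 < m) {t t' : Fin m → ℝ} {cmin cmax : ℝ}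
    (hcmin : 0 < cmin) (hc : ∀ i, c i ∈ Set.Icc cmin cmax) (hpr : ∀ i, 0 < pr i)
    (hl' : ∀ i, 0 < l' i) {δ η r : ℝ} (hδ : 0 < δ) (hr : 0 < r)
    (hη : 2 * η / δ ≤ r / 2)
    (h : (∑ i, |l i - t i|) / m ≤ η) (h' : (∑ i, |l' i - t' i|) / m ≤ η)
    (hcount : r ≤ (∑ i, (if t' i + 2 * δ < t i ∧ t i + δ < α then (1 : ℝ) else 0)) / m) :
    (∑ i ∈ rejections α c pr l l', t i * c i) / ∑ i ∈ rejections α c pr l l', c i ≤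
      α + 2 * cmax * η / (cmin * r) := by
  have hm' : (0 : ℝ) < m := Nat.cast_pos.2 hm
  have hc0 : ∀ i, 0 ≤ c i := fun i => hcmin.le.trans (hc i).1
  have hcmax : 0 < cmax := hcmin.trans_le ((hc ⟨0, hm⟩).1.trans (hc ⟨0, hm⟩).2)
  rw [div_le_iff₀ hm'] at h h'
  rw [le_div_iff₀ hm'] at hcount
  have hcard : r / 2 * m ≤ (rejections α c pr l l').card := by
    have h1 := sum_indicator_sub_le_card_rejections (α := α) (c := c) (l := l) (t := t) (t' := t')
      hpr hl' hδ
    have h2 : (∑ i, |l i - t i| + ∑ i, |l' i - t' i|) / δ ≤ r / 2 * m := by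
      calc _ ≤ (η * m + η * m) / δ := by gcongr
        _ = 2 * η / δ * m := by ring
        _ ≤ r / 2 * m := by gcongr
    linarith
  have hcost : cmin * r / 2 * m ≤ ∑ i ∈ rejections α c pr l l', c i := by
    calc cmin * r / 2 * m = cmin * (r / 2 * m) := by ring
      _ ≤ cmin * (rejections α c pr l l').card := by gcongr
      _ = (rejections α c pr l l').card • cmin := by rw [nsmul_eq_mul, mul_comm]
      _ ≤ _ := Finset.card_nsmul_le_sum _ _ _ fun i _ => (hc i).1
  have hpos : 0 < ∑ i ∈ rejections α c pr l l', c i := lt_of_lt_of_le (by positivity) hcost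
  have hη0 : 0 ≤ η := by
    by_contra hneg
    have : 0 ≤ ∑ i, |l i - t i| := Finset.sum_nonneg fun _ _ => abs_nonneg _
    nlinarith
  rw [div_le_iff₀ hpos, add_mul]
  refine (sum_mul_rejections_le hc0 (fun i => (hc i).2) t).trans (add_le_add_right ?_ _)
  calc cmax * ∑ i, |l i - t i| ≤ cmax * (η * m) := by gcongr
    _ = 2 * cmax * η / (cmin * r) * (cmin * r / 2 * m) := by field_simp
    _ ≤ _ := by gcongr

end Procedure

/-! ### Measurability of the procedure -/

section Measurability

variable {X : Type*} [MeasurableSpace X] {m : ℕ} {α : ℝ} {c pr : Fin m → ℝ} {l l' : X → Fin m → ℝ}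

theorem measurable_weight (hl : ∀ i, Measurable fun x => l x i) (i : Fin m) :
    Measurable fun x => weight α c (l x) i :=
  ((hl i).sub_const α).mul_const (c i)

theorem measurable_value (hl : ∀ i, Measurable fun x => l x i)
    (hl' : ∀ i, Measurable fun x => l' x i) (i : Fin m) :
    Measurable fun x => value pr (l x) (l' x) i :=
  (((hl i).div (hl' i)).sub_const 1).const_mul (pr i)

theorem measurableSet_mem_base (hl : ∀ i, Measurable fun x => l x i) (i : Fin m) :
    MeasurableSet {x | i ∈ base α (l x)} := by
  simp only [mem_base]
  exact measurableSet_lt (hl i) measurable_const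

theorem measurable_capacity (hl : ∀ i, Measurable fun x => l x i) :
    Measurable fun x => capacity α c (l x) := by
  simp only [capacity, base, Finset.sum_filter]
  exact Finset.measurable_sum _ fun i _ => Measurable.ite (measurableSet_lt (hl i) measurable_const)
    ((measurable_const.sub (hl i)).mul_const _) measurable_const

theorem measurableSet_mem_ranked (hl : ∀ i, Measurable fun x => l x i)
    (hl' : ∀ i, Measurable fun x => l' x i) (i : Fin m) :
    MeasurableSet {x | i ∈ ranked α pr (l x) (l' x)} := by
  have hb := measurableSet_mem_base (α := α) hl i
  have hv := measurable_value (pr := pr) hl hl' i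
  have h1 := measurableSet_lt hv (measurable_const (a := (0 : ℝ)))
  have h2 := measurableSet_lt (measurable_const (a := (0 : ℝ))) hv
  have : {x | i ∈ ranked α pr (l x) (l' x)} =
      ({x | i ∈ base α (l x)}ᶜ ∩ {x | value pr (l x) (l' x) i < 0})ᶜ ∩
        ({x | i ∈ base α (l x)} ∩ {x | 0 < value pr (l x) (l' x) i})ᶜ := by
    ext x
    simp [ranked]
  rw [this]
  exact ((hb.compl.inter h1).compl).inter (hb.inter h2).compl

theorem measurable_ratio (hl : ∀ i, Measurable fun x => l x i)
    (hl' : ∀ i, Measurable fun x => l' x i) (i : Fin m) :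
    Measurable fun x => ratio α c pr (l x) (l' x) i := by
  have hw := measurable_weight (α := α) (c := c) hl i
  unfold ratio
  exact Measurable.ite (hw (measurableSet_singleton 0)) measurable_const
    ((measurable_value hl hl' i).div hw).coe_real_ereal

theorem measurableSet_atOrBefore (hl : ∀ i, Measurable fun x => l x i)
    (hl' : ∀ i, Measurable fun x => l' x i) (j i : Fin m) :
    MeasurableSet {x | AtOrBefore α c pr (l x) (l' x) j i} := by
  have hi := measurable_ratio (α := α) (c := c) (pr := pr) hl hl' i
  have hj := measurable_ratio (α := α) (c := c) (pr := pr) hl hl' j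
  exact (measurableSet_lt hi hj).union ((measurableSet_eq_fun hi hj).inter (.const _))

theorem measurable_usedCapacity (hl : ∀ i, Measurable fun x => l x i)
    (hl' : ∀ i, Measurable fun x => l' x i) (i : Fin m) :
    Measurable fun x => usedCapacity α c pr (l x) (l' x) i := by
  classical
  have (x : X) : usedCapacity α c pr (l x) (l' x) i = ∑ j, if j ∈ ranked α pr (l x) (l' x) ∧
      AtOrBefore α c pr (l x) (l' x) j i then |weight α c (l x) j| else 0 := by
    unfold usedCapacity
    rw [← Finset.sum_filter]
    refine Finset.sum_congr ?_ fun _ _ => rfl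
    ext j
    simp
  simp only [this]
  exact Finset.measurable_sum _ fun j _ => Measurable.ite
    ((measurableSet_mem_ranked hl hl' j).inter (measurableSet_atOrBefore hl hl' j i))
    (measurable_weight hl j).abs measurable_const

theorem measurableSet_mem_rejections (hl : ∀ i, Measurable fun x => l x i)
    (hl' : ∀ i, Measurable fun x => l' x i) (i : Fin m) :
    MeasurableSet {x | i ∈ rejections α c pr (l x) (l' x)} := by
  have hb := measurableSet_mem_base (α := α) hl i
  have hs : MeasurableSet {x | i ∈ switched α c pr (l x) (l' x)} := by
    have := (measurableSet_mem_ranked (α := α) (pr := pr) hl hl' i).inter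
      (measurableSet_le (measurable_usedCapacity (α := α) (c := c) (pr := pr) hl hl' i)
        (measurable_capacity (α := α) (c := c) hl))
    convert this using 1
    ext x
    simp [switched]
  have := (hb.diff hs).union (hs.diff hb)
  convert this using 1
  ext x
  simp [rejections]

end Measurability

/-! ### The posterior given all the data -/

theorem measurable_lfdr {π₀ : ℝ} {f₀ f₁ : ℝ → ℝ} (h₀ : Measurable f₀) (h₁ : Measurable f₁) :
    Measurable (lfdr π₀ f₀ f₁) := by
  unfold lfdr mixtureDensity
  fun_prop

theorem lfdr_mem_Icc {π₀ : ℝ} {f₀ f₁ : ℝ → ℝ} (hπ : π₀ ∈ Set.Icc (0 : ℝ) 1) {h : ℝ}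
    (h₀ : 0 ≤ f₀ h) (h₁ : 0 ≤ f₁ h) : lfdr π₀ f₀ f₁ h ∈ Set.Icc (0 : ℝ) 1 := by
  have ha := mul_nonneg hπ.1 h₀
  have hb := mul_nonneg (sub_nonneg.2 hπ.2) h₁
  unfold lfdr mixtureDensity
  exact ⟨div_nonneg ha (add_nonneg ha hb), div_le_one_of_le₀ (by linarith) (add_nonneg ha hb)⟩

namespace TwoGroupModel

variable {Ω : Type*} [MeasurableSpace Ω] {P : Measure Ω} [IsProbabilityMeasure P] {π₀ : ℝ}
  {f₀ f₁ : ℝ → ℝ} {θ : ℕ → Ω → Fin 2} {H S : ℕ → Ω → ℝ}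

/-- The defining property of the posterior, integrated against a bounded function of the data of the
same experiment. -/
theorem integral_null_sub_lfdr_mul (hM : TwoGroupModel P π₀ f₀ f₁ θ H S) (i : ℕ)
    {k : ℝ × ℝ → ℝ} (hk : Measurable k) (hk1 : ∀ x, |k x| ≤ 1) :
    ∫ ω, ((if θ i ω = 0 then 1 else 0) - lfdr π₀ f₀ f₁ (H i ω)) * k (H i ω, S i ω) ∂P = 0 := by
  set X : Ω → ℝ × ℝ := fun ω => (H i ω, S i ω) with hX
  have hXm : Measurable X := (hM.measurable_stat i).prodMk (hM.measurable_scale i)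
  set ind : Ω → ℝ := Set.indicator {ω | θ i ω = 0} (fun _ => (1 : ℝ)) with hind
  have hset : MeasurableSet {ω | θ i ω = 0} := hM.measurable_state i (measurableSet_singleton 0)
  have hint : Integrable ind P := (integrable_const 1).indicator hset
  have hle : MeasurableSpace.comap X inferInstance ≤ (inferInstance : MeasurableSpace Ω) :=
    hXm.comap_le
  have hkX : StronglyMeasurable[MeasurableSpace.comap X inferInstance] (fun ω => k (X ω)) :=
    (hk.comp (comap_measurable X)).stronglyMeasurable
  have hkX' : AEStronglyMeasurable (fun ω => k (X ω)) P := (hk.comp hXm).aestronglyMeasurable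
  have hkb : ∀ᵐ ω ∂P, ‖k (X ω)‖ ≤ 1 := ae_of_all _ fun ω => hk1 _
  have h1 := condExp_stronglyMeasurable_mul_of_bound (μ := P) hle hkX hint 1 hkb
  have h2 : ∫ ω, k (X ω) * ind ω ∂P = ∫ ω, k (X ω) * lfdr π₀ f₀ f₁ (H i ω) ∂P := by
    rw [show (fun ω => k (X ω) * ind ω) = (fun ω => k (X ω)) * ind from rfl,
      ← integral_condExp hle, integral_congr_ae h1]
    refine integral_congr_ae ?_
    filter_upwards [hM.posterior i] with ω hω
    simp only [Pi.mul_apply]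
    rw [hω]
  have hl : Integrable (fun ω => lfdr π₀ f₀ f₁ (H i ω)) P := by
    refine Integrable.of_bound ((measurable_lfdr hM.measurable_null hM.measurable_alt).comp
      (hM.measurable_stat i)).aestronglyMeasurable 1 (ae_of_all _ fun ω => ?_)
    have := lfdr_mem_Icc hM.nullProb_mem (hM.null_nonneg (H i ω)) (hM.alt_nonneg (H i ω))
    rw [Real.norm_eq_abs, abs_of_nonneg this.1]
    exact this.2
  calc _ = ∫ ω, (k (X ω) * ind ω - k (X ω) * lfdr π₀ f₀ f₁ (H i ω)) ∂P := by
        refine integral_congr_ae (ae_of_all _ fun ω => ?_)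
        simp only [hind, Set.indicator_apply, Set.mem_ofPred_eq, hX]
        ring
    _ = 0 := by
        rw [integral_sub (hint.bdd_mul hkX' hkb) (hl.bdd_mul hkX' hkb), h2, sub_self]

/-- As the experiments are independent, `lfdr (H i)` is also the posterior null probability given
the data of all the experiments: the data of the others can be frozen and integrated out last. -/
theorem integral_null_mul_eq (hM : TwoGroupModel P π₀ f₀ f₁ θ H S) {m : ℕ} (i : Fin m)
    {g : (Fin m → ℝ × ℝ) → ℝ} (hg : Measurable g) (hg1 : ∀ x, |g x| ≤ 1) :
    ∫ ω, ((if θ i ω = 0 then 1 else 0) - lfdr π₀ f₀ f₁ (H i ω)) * g (data H S m ω) ∂P = 0 := by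
  set Z : ℕ → Ω → Fin 2 × ℝ × ℝ := fun j ω => (θ j ω, H j ω, S j ω) with hZ
  have hZm : ∀ j, Measurable (Z j) := fun j =>
    (hM.measurable_state j).prodMk ((hM.measurable_stat j).prodMk (hM.measurable_scale j))
  -- The data of the other experiments, with a dummy entry at `i`.
  let W : Ω → Fin m → ℝ × ℝ := fun ω j => if j = i then 0 else (Z j ω).2
  have hW : Measurable W := by
    refine measurable_pi_lambda _ fun j => ?_
    by_cases h : j = i
    · simp only [W, h, if_true]; exact measurable_const
    · simp only [W, h, if_false]; exact (hZm j).snd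
  have hind : IndepFun (Z i) W P := by
    have h0 := hM.indep.indepFun_finset {(i : ℕ)} ((Finset.range m).erase i)
      (by simp) hZm
    let φ : (({(i : ℕ)} : Finset ℕ) → Fin 2 × ℝ × ℝ) → Fin 2 × ℝ × ℝ :=
      fun u => u ⟨i, Finset.mem_singleton_self _⟩
    let ψ : (((Finset.range m).erase i : Finset ℕ) → Fin 2 × ℝ × ℝ) → Fin m → ℝ × ℝ :=
      fun v j => if h : j = i then 0 else (v ⟨j, Finset.mem_erase.2
        ⟨fun e => h (Fin.ext e), Finset.mem_range.2 j.2⟩⟩).2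
    have hφ : Measurable φ := measurable_pi_apply _
    have hψ : Measurable ψ := by
      refine measurable_pi_lambda _ fun j => ?_
      by_cases h : j = i
      · simp only [ψ, h, dif_pos]; exact measurable_const
      · simp only [ψ, h, dif_neg, not_false_iff]; exact (measurable_pi_apply _).snd
    have h1 := h0.comp hφ hψ
    have e2 : (ψ ∘ fun a (j : ((Finset.range m).erase i : Finset ℕ)) => Z j a) = W := by
      funext ω j
      by_cases h : j = i <;> simp [ψ, W, h]
    rw [← e2]
    exact h1
  have hlm := measurable_lfdr (π₀ := π₀) hM.measurable_null hM.measurable_alt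
  let F : (Fin 2 × ℝ × ℝ) × (Fin m → ℝ × ℝ) → ℝ := fun q =>
    ((if q.1.1 = 0 then 1 else 0) - lfdr π₀ f₀ f₁ q.1.2.1) * g (Function.update q.2 i q.1.2)
  have hupd : Measurable fun q : (Fin 2 × ℝ × ℝ) × (Fin m → ℝ × ℝ) =>
      Function.update q.2 i q.1.2 := by
    refine measurable_pi_lambda _ fun j => ?_
    by_cases h : j = i
    · subst h; simp only [Function.update_self]; fun_prop
    · simp only [Function.update_of_ne h]; fun_prop
  have hF : Measurable F := by
    refine Measurable.mul (Measurable.sub (Measurable.ite ?_ measurable_const measurable_const)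
      (hlm.comp measurable_fst.snd.fst)) (hg.comp hupd)
    exact measurable_fst.fst (measurableSet_singleton 0)
  have hF1 : ∀ q, ‖F q‖ ≤ 1 := fun q => by
    have := lfdr_mem_Icc hM.nullProb_mem (hM.null_nonneg q.1.2.1) (hM.alt_nonneg q.1.2.1)
    rw [Real.norm_eq_abs, abs_mul]
    refine mul_le_one₀ (abs_le.2 ?_) (abs_nonneg _) (hg1 _)
    constructor <;> split_ifs <;> linarith [this.1, this.2]
  have hdata : ∀ ω, F (Z i ω, W ω) =
      ((if θ i ω = 0 then 1 else 0) - lfdr π₀ f₀ f₁ (H i ω)) * g (data H S m ω) := by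
    intro ω
    have : Function.update (W ω) i (Z i ω).2 = data H S m ω := by
      funext j
      by_cases h : j = i
      · subst h; simp [data, hZ]
      · simp [W, h, data, hZ]
    simp only [F, this]
    rfl
  have : IsProbabilityMeasure (P.map (Z i)) := Measure.isProbabilityMeasure_map (hZm i).aemeasurable
  have : IsProbabilityMeasure (P.map W) := Measure.isProbabilityMeasure_map hW.aemeasurable
  calc _ = ∫ ω, F (Z i ω, W ω) ∂P := by simp only [hdata]
    _ = ∫ q, F q ∂((P.map (Z i)).prod (P.map W)) := by
        rw [← (indepFun_iff_map_prod_eq_prod_map_map (hZm i).aemeasurable hW.aemeasurable).1 hind,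
          integral_map ((hZm i).prodMk hW).aemeasurable hF.aestronglyMeasurable]
    _ = ∫ w, ∫ z, F (z, w) ∂(P.map (Z i)) ∂(P.map W) :=
        integral_prod_symm _ (Integrable.of_bound hF.aestronglyMeasurable 1 (ae_of_all _ hF1))
    _ = ∫ w, 0 ∂(P.map W) := by
        refine integral_congr_ae (ae_of_all _ fun w => ?_)
        simp only
        have hFw : Measurable fun z => F (z, w) := hF.comp measurable_prodMk_right
        rw [integral_map (hZm i).aemeasurable hFw.aestronglyMeasurable]
        exact hM.integral_null_sub_lfdr_mul i
          (hg.comp (measurable_update w)) fun _ => hg1 _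
    _ = 0 := integral_zero _ _

end TwoGroupModel

/-! ### The frequency of tests secured with a margin -/

/-- If the strict inequalities `v < u < α` have positive probability, they hold with a uniform margin, at the expense
of half of the probability. -/
theorem exists_margin {Ω : Type*} [MeasurableSpace Ω] {P : Measure Ω}
    [IsProbabilityMeasure P] {u v : Ω → ℝ} {α p : ℝ} (hp : 0 < p)
    (hmass : p ≤ P.real {ω | v ω < u ω ∧ u ω < α}) :
    ∃ δ > 0, p / 2 < P.real {ω | v ω + 2 * δ < u ω ∧ u ω + δ < α} := by
  let s : ℕ → Set Ω := fun n => {ω | v ω + 2 * (1 / ((n : ℝ) + 1)) < u ω ∧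
    u ω + 1 / ((n : ℝ) + 1) < α}
  have hmono : Monotone s := fun a b hab ω hω => by
    have := Nat.one_div_le_one_div (α := ℝ) hab
    exact ⟨by linarith [hω.1], by linarith [hω.2]⟩
  have hunion : ⋃ n, s n = {ω | v ω < u ω ∧ u ω < α} := by
    ext ω
    simp only [Set.mem_iUnion]
    constructor
    · rintro ⟨n, h1, h2⟩
      have : 0 < 1 / ((n : ℝ) + 1) := Nat.one_div_pos_of_nat
      exact ⟨by linarith, by linarith⟩
    · rintro ⟨h1, h2⟩
      obtain ⟨n, hn⟩ := exists_nat_one_div_lt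
        (lt_min (half_pos (sub_pos.2 h1)) (sub_pos.2 h2))
      rw [lt_min_iff] at hn
      exact ⟨n, by linarith [hn.1], by linarith [hn.2]⟩
  have hlim := tendsto_measure_iUnion_atTop (μ := P) hmono
  rw [hunion] at hlim
  have hlim' := (ENNReal.tendsto_toReal (measure_ne_top P _)).comp hlim
  obtain ⟨n, hn⟩ := (hlim'.eventually (lt_mem_nhds
    (show p / 2 < P.real {ω | v ω < u ω ∧ u ω < α} by linarith))).exists
  exact ⟨_, Nat.one_div_pos_of_nat (n := n), hn⟩

namespace TwoGroupModel

variable {Ω : Type*} [MeasurableSpace Ω] {P : Measure Ω} [IsProbabilityMeasure P] {π₀ : ℝ}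
  {f₀ f₁ : ℝ → ℝ} {θ : ℕ → Ω → Fin 2} {H S : ℕ → Ω → ℝ}

/-- The law of large numbers for an event that depends on the data of one experiment. -/
theorem tendstoInMeasure_frequency (hM : TwoGroupModel P π₀ f₀ f₁ θ H S) {q : ℝ × ℝ → Prop}
    [DecidablePred q] (hq : MeasurableSet {x | q x}) :
    TendstoInMeasure P
      (fun (m : ℕ) ω => (∑ i : Fin m, if q (H i ω, S i ω) then (1 : ℝ) else 0) / (m : ℝ))
      atTop (fun _ => P.real {ω | q (H 0 ω, S 0 ω)}) := by
  let F : Fin 2 × ℝ × ℝ → ℝ := fun z => if q z.2 then 1 else 0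
  have hF : Measurable F := Measurable.ite (measurable_snd hq) measurable_const measurable_const
  have hX : ∀ i, Measurable fun ω => (H i ω, S i ω) := fun i =>
    (hM.measurable_stat i).prodMk (hM.measurable_scale i)
  let X : ℕ → Ω → ℝ := fun i ω => if q (H i ω, S i ω) then 1 else 0
  have hXm : ∀ i, Measurable (X i) := fun i =>
    hF.comp ((hM.measurable_state i).prodMk (hX i))
  have hlln := strong_law_ae_real (μ := P) X
    (Integrable.of_bound (hXm 0).aestronglyMeasurable 1 (ae_of_all _ fun ω => by
      simp only [X]; split_ifs <;> simp))
    (fun i j hij => (hM.indep.indepFun hij).comp hF hF)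
    (fun i => (hM.ident i).comp hF)
  have hmean : ∫ ω, X 0 ω ∂P = P.real {ω | q (H 0 ω, S 0 ω)} := by
    rw [← integral_indicator_one (show MeasurableSet {ω | q (H 0 ω, S 0 ω)} from hX 0 hq)]
    refine integral_congr_ae (ae_of_all _ fun ω => ?_)
    simp [X, Set.indicator_apply]
  rw [hmean] at hlln
  refine tendstoInMeasure_of_tendsto_ae (fun m => ?_) ?_
  · exact ((Finset.measurable_sum _ fun (i : Fin m) _ => hXm i).div_const _).aestronglyMeasurable
  · filter_upwards [hlln] with ω hω
    refine hω.congr fun m => ?_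
    rw [Finset.sum_range]

end TwoGroupModel

/-! ### Cost shares of the rejected tests -/

section Share

variable {m : ℕ} (α : ℝ) (c pr : Fin m → ℝ) (hat : (Fin m → ℝ × ℝ) → ℝ → ℝ)

/-- The rejections as a function of the data, for a given estimator of the lfdr. -/
noncomputable def rejectionsOf (x : Fin m → ℝ × ℝ) : Finset (Fin m) :=
  rejections α c pr (fun i => hat x (x i).1) (fun i => hat x ((x i).1 + (x i).2))

/-- The share of test `i` in the total cost of the rejected tests; it is `0` if `i` is not
rejected. -/
noncomputable def share (i : Fin m) (x : Fin m → ℝ × ℝ) : ℝ :=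
  if i ∈ rejectionsOf α c pr hat x then c i / ∑ j ∈ rejectionsOf α c pr hat x, c j else 0

variable {α c pr hat}

theorem measurable_share (hhat : Measurable (Function.uncurry hat)) (i : Fin m) :
    Measurable (share α c pr hat i) := by
  have hR : ∀ j, MeasurableSet {x | j ∈ rejectionsOf α c pr hat x} := fun j =>
    measurableSet_mem_rejections (α := α) (c := c) (pr := pr)
      (fun k => hhat.comp (measurable_id.prodMk (measurable_pi_apply k).fst))
      (fun k => hhat.comp (measurable_id.prodMk
        ((measurable_pi_apply k).fst.add (measurable_pi_apply k).snd))) j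
  have hsum : Measurable fun x => ∑ j ∈ rejectionsOf α c pr hat x, c j := by
    have (x : Fin m → ℝ × ℝ) : ∑ j ∈ rejectionsOf α c pr hat x, c j
        = ∑ j, if j ∈ rejectionsOf α c pr hat x then c j else 0 := by simp
    simp only [this]
    exact Finset.measurable_sum _ fun j _ => Measurable.ite (hR j) measurable_const measurable_const
  exact Measurable.ite (hR i) (measurable_const.div hsum) measurable_const

theorem abs_share_le_one (hc : ∀ i, 0 ≤ c i) (i : Fin m) (x : Fin m → ℝ × ℝ) :
    |share α c pr hat i x| ≤ 1 := by
  unfold share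
  split_ifs with h
  · have h1 := Finset.single_le_sum (fun j _ => hc j) h
    have h0 := (hc i).trans h1
    rw [abs_of_nonneg (div_nonneg (hc i) h0)]
    exact div_le_one_of_le₀ h1 h0
  · simp

/-- The shares turn the cost-weighted average of `t` over the rejected tests into a sum over all
tests with bounded weights that are measurable in the data. -/
theorem sum_mul_share (t : Fin m → ℝ) (x : Fin m → ℝ × ℝ) :
    ∑ i, t i * share α c pr hat i x =
      (∑ i ∈ rejectionsOf α c pr hat x, t i * c i) / ∑ i ∈ rejectionsOf α c pr hat x, c i := by
  simp only [share, mul_ite, mul_zero, Finset.sum_ite_mem, Finset.univ_inter, Finset.sum_div,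
    mul_div_assoc]

theorem sum_mul_share_le_one (hc : ∀ i, 0 ≤ c i) {t : Fin m → ℝ} (ht : ∀ i, t i ≤ 1)
    (x : Fin m → ℝ × ℝ) : ∑ i, t i * share α c pr hat i x ≤ 1 := by
  rw [sum_mul_share]
  exact div_le_one_of_le₀ (Finset.sum_le_sum fun i _ => mul_le_of_le_one_left (hc i) (ht i))
    (Finset.sum_nonneg fun i _ => hc i)

end Share

/-! ### The false discovery rate -/

section FDR

variable {Ω : Type*} {π₀ : ℝ} {f₀ f₁ : ℝ → ℝ} {θ : ℕ → Ω → Fin 2} {H S : ℕ → Ω → ℝ}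
  {α : ℝ} {c pr : ℕ → ℝ} {lfdrHat : (m : ℕ) → (Fin m → ℝ × ℝ) → ℝ → ℝ}

theorem fdp_eq_sum_share (m : ℕ) (ω : Ω) :
    fdp α c pr lfdrHat θ H S m ω = ∑ i : Fin m, (if θ i ω = 0 then 1 else 0) *
      share α (fun i => c i) (fun i => pr i) (lfdrHat m) i (data H S m ω) := by
  rw [sum_mul_share]
  simp only [ite_mul, one_mul, zero_mul]
  rfl

namespace TwoGroupModel

variable [MeasurableSpace Ω] {P : Measure Ω}

theorem measurable_data (hM : TwoGroupModel P π₀ f₀ f₁ θ H S) (m : ℕ) :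
    Measurable (data H S m) :=
  measurable_pi_lambda _ fun i => (hM.measurable_stat i).prodMk (hM.measurable_scale i)

theorem measurable_null_indicator (hM : TwoGroupModel P π₀ f₀ f₁ θ H S) (i : ℕ) :
    Measurable fun ω => if θ i ω = 0 then (1 : ℝ) else 0 :=
  Measurable.ite (hM.measurable_state i (measurableSet_singleton 0)) measurable_const
    measurable_const

theorem lfdr_mem_Icc (hM : TwoGroupModel P π₀ f₀ f₁ θ H S) (h : ℝ) :
    lfdr π₀ f₀ f₁ h ∈ Set.Icc (0 : ℝ) 1 :=
  RBL.lfdr_mem_Icc hM.nullProb_mem (hM.null_nonneg h) (hM.alt_nonneg h)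

variable [IsProbabilityMeasure P]

theorem integrable_mul_share (hM : TwoGroupModel P π₀ f₀ f₁ θ H S) (hc : ∀ i, 0 ≤ c i)
    (hhat : ∀ m, Measurable (Function.uncurry (lfdrHat m))) {m : ℕ} (i : Fin m) {t : Ω → ℝ}
    (ht : Measurable t) (ht1 : ∀ ω, t ω ∈ Set.Icc (0 : ℝ) 1) :
    Integrable (fun ω => t ω *
      share α (fun i => c i) (fun i => pr i) (lfdrHat m) i (data H S m ω)) P := by
  refine Integrable.of_bound
    (ht.mul ((measurable_share (hhat m) i).comp (hM.measurable_data m))).aestronglyMeasurable 1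
    (ae_of_all _ fun ω => ?_)
  rw [Real.norm_eq_abs, abs_mul]
  exact mul_le_one₀ ((abs_of_nonneg (ht1 ω).1).trans_le (ht1 ω).2) (abs_nonneg _)
    (abs_share_le_one (fun i => hc i) i _)

theorem integrable_fdp (hM : TwoGroupModel P π₀ f₀ f₁ θ H S) (hc : ∀ i, 0 ≤ c i)
    (hhat : ∀ m, Measurable (Function.uncurry (lfdrHat m))) (m : ℕ) :
    Integrable (fdp α c pr lfdrHat θ H S m) P := by
  rw [show fdp α c pr lfdrHat θ H S m = _ from funext fun ω => fdp_eq_sum_share m ω]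
  exact integrable_finsetSum _ fun i _ => hM.integrable_mul_share hc hhat i
    (hM.measurable_null_indicator i) fun ω => by split_ifs <;> simp

theorem integrable_lfdr_mul_share (hM : TwoGroupModel P π₀ f₀ f₁ θ H S) (hc : ∀ i, 0 ≤ c i)
    (hhat : ∀ m, Measurable (Function.uncurry (lfdrHat m))) {m : ℕ} (i : Fin m) :
    Integrable (fun ω => lfdr π₀ f₀ f₁ (H i ω) *
      share α (fun i => c i) (fun i => pr i) (lfdrHat m) i (data H S m ω)) P :=
  hM.integrable_mul_share hc hhat i
    ((measurable_lfdr hM.measurable_null hM.measurable_alt).comp (hM.measurable_stat i))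
    fun _ => hM.lfdr_mem_Icc _

/-- The rejections depend only on the observed data, so the unobserved states may be replaced by
their posterior probabilities. -/
theorem fdr_eq_integral_lfdr (hM : TwoGroupModel P π₀ f₀ f₁ θ H S) (hc : ∀ i, 0 ≤ c i)
    (hhat : ∀ m, Measurable (Function.uncurry (lfdrHat m))) (m : ℕ) :
    fdr α c pr lfdrHat θ H S P m = ∫ ω, ∑ i : Fin m, lfdr π₀ f₀ f₁ (H i ω) *
      share α (fun i => c i) (fun i => pr i) (lfdrHat m) i (data H S m ω) ∂P := by
  have hi : ∀ i : Fin m, _ := fun i => hM.integrable_mul_share (α := α) (pr := pr) hc hhat i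
    (hM.measurable_null_indicator i) fun ω => by split_ifs <;> simp
  have hl : ∀ i : Fin m, _ := fun i =>
    hM.integrable_lfdr_mul_share (α := α) (pr := pr) hc hhat i
  simp only [fdr, fdp_eq_sum_share]
  rw [integral_finsetSum _ fun i _ => hi i, integral_finsetSum _ fun i _ => hl i]
  refine Finset.sum_congr rfl fun i _ => sub_eq_zero.1 ?_
  rw [← integral_sub (hi i) (hl i)]
  simp only [← sub_mul]
  exact hM.integral_null_mul_eq i (measurable_share (hhat m) i)
    (abs_share_le_one (fun i => hc i) i)

/-- The consistency of the estimates enters only in probability; on the exceptional event the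
average lfdr of the rejected tests is bounded by one. -/
theorem eventually_fdr_le (hM : TwoGroupModel P π₀ f₀ f₁ θ H S) (hα : 0 < α)
    {cmin cmax : ℝ} (hcmin : 0 < cmin) (hc : ∀ i, c i ∈ Set.Icc cmin cmax)
    (hpr : ∀ i, 0 < pr i)
    (hhat : ∀ m, Measurable (Function.uncurry (lfdrHat m)))
    (hpos : ∀ m x h, 0 < lfdrHat m x h)
    (hcons : TendstoInMeasure P
      (fun (m : ℕ) ω => (∑ i : Fin m,
        |lfdrHat m (data H S m ω) (H i ω) - lfdr π₀ f₀ f₁ (H i ω)|) / (m : ℝ))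
      atTop (fun _ => (0 : ℝ)))
    (hcons_shift : TendstoInMeasure P
      (fun (m : ℕ) ω => (∑ i : Fin m,
        |lfdrHat m (data H S m ω) (H i ω + S i ω) - lfdr π₀ f₀ f₁ (H i ω + S i ω)|) / (m : ℝ))
      atTop (fun _ => (0 : ℝ)))
    {p : ℝ} (hp : 0 < p)
    (hmass : p ≤ P.real {ω | lfdr π₀ f₀ f₁ (H 0 ω + S 0 ω) < lfdr π₀ f₀ f₁ (H 0 ω) ∧
      lfdr π₀ f₀ f₁ (H 0 ω) < α}) {ε : ℝ} (hε : 0 < ε) :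
    ∀ᶠ m in atTop, fdr α c pr lfdrHat θ H S P m ≤ α + ε := by
  classical
  have hc0 : ∀ i, 0 ≤ c i := fun i => hcmin.le.trans (hc i).1
  have hcmax : 0 < cmax := hcmin.trans_le ((hc 0).1.trans (hc 0).2)
  have hlm := measurable_lfdr (π₀ := π₀) hM.measurable_null hM.measurable_alt
  obtain ⟨δ, hδ, hgap⟩ := exists_margin hp hmass
  let q : ℝ × ℝ → Prop := fun x =>
    lfdr π₀ f₀ f₁ (x.1 + x.2) + 2 * δ < lfdr π₀ f₀ f₁ x.1 ∧ lfdr π₀ f₀ f₁ x.1 + δ < α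
  have hq : MeasurableSet {x | q x} :=
    (measurableSet_lt ((hlm.comp (measurable_fst.add measurable_snd)).add_const _)
      (hlm.comp measurable_fst)).inter
      (measurableSet_lt ((hlm.comp measurable_fst).add_const _) measurable_const)
  have hfreq := hM.tendstoInMeasure_frequency hq
  -- Below `η`, the errors cost at most half of the secured tests, and the average lfdr over the
  -- rejections is at most `α + ε / 2`.
  set η : ℝ := min (δ * p / 16) (ε * cmin * p / (16 * cmax)) with hη
  have hη0 : 0 < η := by positivity
  rw [tendstoInMeasure_iff_measureReal_dist] at hcons hcons_shift hfreq
  have hε6 : (0 : ℝ) < ε / 6 := by positivity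
  filter_upwards [(hcons η hη0).eventually (gt_mem_nhds hε6),
    (hcons_shift η hη0).eventually (gt_mem_nhds hε6),
    (hfreq (p / 4) (by positivity)).eventually (gt_mem_nhds hε6), eventually_gt_atTop 0]
    with m h1 h2 h3 hm
  set B₁ := {ω | η ≤ dist ((∑ i : Fin m,
        |lfdrHat m (data H S m ω) (H i ω) - lfdr π₀ f₀ f₁ (H i ω)|) / (m : ℝ)) 0} with hB₁
  set B₂ := {ω | η ≤ dist ((∑ i : Fin m,
        |lfdrHat m (data H S m ω) (H i ω + S i ω)
          - lfdr π₀ f₀ f₁ (H i ω + S i ω)|) / (m : ℝ)) 0} with hB₂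
  set B₃ := {ω | p / 4 ≤ dist ((∑ i : Fin m, if q (H i ω, S i ω) then (1 : ℝ) else 0) / (m : ℝ))
      (P.real {ω | q (H 0 ω, S 0 ω)})} with hB₃
  -- A measurable superset of the same probability spares the measurability of the three events.
  set B := toMeasurable P (B₁ ∪ B₂ ∪ B₃) with hB
  have hBm : MeasurableSet B := measurableSet_toMeasurable _ _
  have hBP : P.real B ≤ ε / 2 := by
    have e : P.real B = P.real (B₁ ∪ B₂ ∪ B₃) := by
      rw [measureReal_def, hB, measure_toMeasurable, measureReal_def]
    have u1 := measureReal_union_le (μ := P) (B₁ ∪ B₂) B₃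
    have u2 := measureReal_union_le (μ := P) B₁ B₂
    linarith
  have hpt : ∀ ω, ∑ i : Fin m, lfdr π₀ f₀ f₁ (H i ω) *
      share α (fun i => c i) (fun i => pr i) (lfdrHat m) i (data H S m ω) ≤
      α + ε / 2 + B.indicator (fun _ => (1 : ℝ)) ω := by
    intro ω
    by_cases hω : ω ∈ B
    · rw [Set.indicator_of_mem hω]
      have := sum_mul_share_le_one (α := α) (c := fun i : Fin m => c i)
        (pr := fun i : Fin m => pr i) (hat := lfdrHat m) (fun i => hc0 i)
        (t := fun i : Fin m => lfdr π₀ f₀ f₁ (H i ω))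
        (fun i => (hM.lfdr_mem_Icc _).2) (data H S m ω)
      linarith
    · have hgood : ω ∉ B₁ ∪ B₂ ∪ B₃ := fun h => hω (subset_toMeasurable _ _ h)
      simp only [Set.mem_union, not_or] at hgood
      obtain ⟨⟨g1, g2⟩, g3⟩ := hgood
      rw [hB₁, Set.mem_ofPred_eq, not_le] at g1
      rw [hB₂, Set.mem_ofPred_eq, not_le] at g2
      rw [hB₃, Set.mem_ofPred_eq, not_le] at g3
      rw [Real.dist_0_eq_abs] at g1 g2
      rw [Real.dist_eq] at g3
      have hfr := (abs_lt.1 g3).1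
      have hgap' : p / 2 < P.real {ω | q (H 0 ω, S 0 ω)} := hgap
      rw [Set.indicator_of_notMem hω, add_zero, sum_mul_share]
      have hmain := sum_mul_rejections_div_le hm (α := α) (c := fun i : Fin m => c i)
        (pr := fun i : Fin m => pr i)
        (l := fun i => lfdrHat m (data H S m ω) (H i ω))
        (l' := fun i => lfdrHat m (data H S m ω) (H i ω + S i ω))
        (t := fun i => lfdr π₀ f₀ f₁ (H i ω)) (t' := fun i => lfdr π₀ f₀ f₁ (H i ω + S i ω))
        hcmin (fun i => hc i) (fun i => hpr i) (fun i => hpos _ _ _) hδ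
        (r := p / 4) (η := η) (by positivity) (by
          rw [div_le_iff₀ hδ]
          have := min_le_left (δ * p / 16) (ε * cmin * p / (16 * cmax))
          rw [← hη] at this
          linarith)
        ((le_abs_self _).trans g1.le) ((le_abs_self _).trans g2.le)
        (show p / 4 ≤ (∑ i : Fin m, if q (H i ω, S i ω) then (1 : ℝ) else 0) / (m : ℝ) by
          linarith)
      refine hmain.trans (add_le_add_right ?_ _)
      rw [div_le_iff₀ (by positivity)]
      calc 2 * cmax * η ≤ 2 * cmax * (ε * cmin * p / (16 * cmax)) := by
            gcongr
            exact min_le_right _ _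
        _ = ε / 2 * (cmin * (p / 4)) := by field_simp; ring
  rw [hM.fdr_eq_integral_lfdr hc0 hhat m]
  have hI : Integrable (B.indicator fun _ => (1 : ℝ)) P := (integrable_const 1).indicator hBm
  calc _ ≤ ∫ ω, (α + ε / 2 + B.indicator (fun _ => (1 : ℝ)) ω) ∂P :=
        integral_mono (integrable_finsetSum _ fun i _ => hM.integrable_lfdr_mul_share hc0 hhat i)
          ((integrable_const _).add hI) hpt
    _ = α + ε / 2 + P.real B := by
        rw [integral_add (integrable_const _) hI, integral_indicator_const _ hBm]
        simp
    _ ≤ α + ε := by linarith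

end TwoGroupModel

end FDR

end RBL

theorem mainTheorem3 {Ω : Type*} [MeasurableSpace Ω] (P : Measure Ω) [IsProbabilityMeasure P]
    (π₀ : ℝ) (f₀ f₁ : ℝ → ℝ) (θ : ℕ → Ω → Fin 2) (H S : ℕ → Ω → ℝ)
    (hmodel : RBL.TwoGroupModel P π₀ f₀ f₁ θ H S)
    (α : ℝ) (hα : 0 < α)
    (c pr : ℕ → ℝ) (cmin cmax : ℝ) (hcmin : 0 < cmin) (hc : ∀ i, c i ∈ Set.Icc cmin cmax)
    (hpr : ∀ i, 0 < pr i)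
    (lfdrHat : (m : ℕ) → (Fin m → ℝ × ℝ) → ℝ → ℝ)
    (hHat_meas : ∀ m, Measurable (Function.uncurry (lfdrHat m)))
    (hHat_mem : ∀ m x h, lfdrHat m x h ∈ Set.Ioc (0 : ℝ) 1)
    (hcons : TendstoInMeasure P
      (fun (m : ℕ) ω => (∑ i : Fin m,
        |lfdrHat m (RBL.data H S m ω) (H i ω) - RBL.lfdr π₀ f₀ f₁ (H i ω)|) / (m : ℝ))
      atTop (fun _ => (0 : ℝ)))
    (hcons_shift : TendstoInMeasure P
      (fun (m : ℕ) ω => (∑ i : Fin m,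
        |lfdrHat m (RBL.data H S m ω) (H i ω + S i ω)
          - RBL.lfdr π₀ f₀ f₁ (H i ω + S i ω)|) / (m : ℝ))
      atTop (fun _ => (0 : ℝ)))
    (p : ℝ) (hp : 0 < p)
    (hmass : p ≤ P.real {ω | RBL.lfdr π₀ f₀ f₁ (H 0 ω + S 0 ω) < RBL.lfdr π₀ f₀ f₁ (H 0 ω) ∧
      RBL.lfdr π₀ f₀ f₁ (H 0 ω) < α}) :
    (∀ m, Integrable (RBL.fdp α c pr lfdrHat θ H S m) P) ∧
      ∃ err : ℕ → ℝ, Tendsto err atTop (𝓝 0) ∧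
        ∀ m, RBL.fdr α c pr lfdrHat θ H S P m ≤ α + err m := by
  have hc0 : ∀ i, 0 ≤ c i := fun i => hcmin.le.trans (hc i).1
  refine ⟨fun m => hmodel.integrable_fdp hc0 hHat_meas m,
    fun m => max (RBL.fdr α c pr lfdrHat θ H S P m - α) 0, ?_,
    fun m => by linarith [le_max_left (RBL.fdr α c pr lfdrHat θ H S P m - α) 0]⟩
  rw [tendsto_order]
  refine ⟨fun a ha => Eventually.of_forall fun m => ha.trans_le (le_max_right _ _), fun a ha => ?_⟩
  filter_upwards [hmodel.eventually_fdr_le hα hcmin hc hpr hHat_meas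
    (fun m x h => (hHat_mem m x h).1) hcons hcons_shift hp hmass (half_pos ha)] with m hm
  exact max_lt (by linarith) ha
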